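/- For a finite simple graph $G$ let $\alpha(G)$ be its independence number and $V_i(G)$ the set of its vertices of degree $i$. Let $\mathcal G$ be the class of connected graphs $G\ne K_4$ with maximum degree at most $3$ and at least three vertices. Let $\mathcal A$ be the smallest class of graphs (up to isomorphism) such that $K_3\in\mathcal A$ and such that, whenever $G'\in\mathcal A$ and $x\in V_2(G')$, the graph obtained from the disjoint union of $G'$ and $K_3$ by adding an edge between $x$ and a vertex of the $K_3$ belongs to $\mathcal A$. Let $\mathcal B$ be the class of graphs obtained from a path $P_n$ on $n\ge 2$ vertices by adding a pendant edge at every vertex of $P_n$. Then for all $G\in\mathcal G$ \[ \alpha(G)\ \ge\ \tfrac57|V_1(G)|+\tfrac37|V_2(G)|+\tfrac27|V_3(G)|-\tfrac27 , \] and equality holds for every $G\in\mathcal A\cup\mathcal B$. -/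

import Mathlib

universe u

namespace SubcubicIndependence

/-- `V_i(G)`: the set of vertices of degree `i`. -/
def degreeClass {V : Type u} [Fintype V] (G : SimpleGraph V) [DecidableRel G.Adj] (i : ℕ) :
    Finset V :=
  Finset.univ.filter fun v => G.degree v = i

/-- The class `𝒢`: connected graphs of maximum degree at most three on at least three vertices
that are not (isomorphic to) `K₄`. -/
structure ClassG {V : Type u} [Fintype V] (G : SimpleGraph V) [DecidableRel G.Adj] : Prop where
  connected : G.Connected
  subcubic : G.maxDegree ≤ 3
  three_le_card : 3 ≤ Fintype.card V
  ne_K4 : IsEmpty (G ≃g (⊤ : SimpleGraph (Fin 4)))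

/-- The disjoint union of `G` and a triangle `K₃`, together with one additional edge joining the
vertex `x` of `G` to the vertex `w` of the triangle. -/
def addTriangle {V : Type u} (G : SimpleGraph V) (x : V) (w : Fin 3) :
    SimpleGraph (V ⊕ Fin 3) :=
  (G ⊕g (⊤ : SimpleGraph (Fin 3))) ⊔ SimpleGraph.edge (Sum.inl x) (Sum.inr w)

/-- The class `𝒜`, closed under isomorphism: it contains `K₃`, and with `G'` it contains every
graph obtained from the disjoint union of `G'` and `K₃` by joining a vertex of degree two in `G'`
to a vertex of the `K₃`. -/
inductive ClassA : {V : Type u} → SimpleGraph V → Prop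
  | triangle {V : Type u} (G : SimpleGraph V) (e : G ≃g (⊤ : SimpleGraph (Fin 3))) : ClassA G
  | step {V' V : Type u} (G' : SimpleGraph V') (hG' : ClassA G')
      (x : V') [Fintype (G'.neighborSet x)] (hx : G'.degree x = 2) (w : Fin 3)
      (G : SimpleGraph V) (e : G ≃g addTriangle G' x w) : ClassA G

/-- The graph obtained from `G` by adding a pendant edge at every vertex: `Sum.inl v` is the
original vertex `v`, and `Sum.inr v` is the new vertex, adjacent to `v` only. -/
def addPendants {V : Type u} (G : SimpleGraph V) : SimpleGraph (V ⊕ V) where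
  Adj
    | .inl v, .inl w => G.Adj v w
    | .inl v, .inr w => v = w
    | .inr v, .inl w => v = w
    | .inr _, .inr _ => False
  symm := ⟨by
    rintro (v | v) (w | w) h
    · exact SimpleGraph.Adj.symm h
    · exact Eq.symm h
    · exact Eq.symm h
    · exact h⟩
  loopless := ⟨by
    rintro (v | v) h
    · exact G.loopless.irrefl v h
    · exact h⟩

/-- The class `ℬ`, closed under isomorphism: the graphs obtained from a path `P_n` on `n ≥ 2`
vertices by adding a pendant edge at every vertex. -/
def ClassB {V : Type u} (G : SimpleGraph V) : Prop :=
  ∃ n : ℕ, 2 ≤ n ∧ Nonempty (G ≃g addPendants (SimpleGraph.pathGraph n))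

end SubcubicIndependence

namespace SubcubicIndependence

/-! Multiply by 7 and give vertices of degree 0, 1, 2, 3 the weights 9, 5, 3, 2. By induction, a
connected subcubic graph with total weight W satisfies 7α ≥ W - 2, or W - 3 if it has exactly two
vertices. The value 9 makes a single vertex tight, the extra 1 makes K₂ tight.

Take a non-cut vertex v (`ConnIn.exists_erase`). If v has degree 3, delete it. Otherwise put v into
the independent set and delete v and its neighbours; what is left may be disconnected, and each
component costs 2. Two facts pay for this. A vertex gains at least 1 in weight for each edge it
loses (`weight_add_le`), so a set may be charged its old weights plus its boundary edges: this is
`boundaryWeight`. And deleting a vertex of degree d creates at most d - 1 new components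
(`Transversal.exists_erase`), where a transversal serves as an upper bound for their number. The
neighbours of v have degree 2 or 3, and weight + degree = 5 in both cases, which makes the accounts
balance exactly.

For equality, each added triangle raises α by 1 and the total weight by 7, starting from K₃; for
paths with pendant edges both sides are computed directly. -/

/-- The number of neighbours of `v` in the vertex set `S`. -/
def degIn {V : Type u} (G : SimpleGraph V) [DecidableRel G.Adj] (S : Finset V) (v : V) : ℕ :=
  (S.filter (G.Adj v)).card

/-- The weight of a vertex of given degree. -/
def weight : ℕ → ℤ
  | 0 => 9
  | 1 => 5
  | 2 => 3
  | _ => 2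

theorem weight_one : weight 1 = 5 := rfl

theorem weight_two : weight 2 = 3 := rfl

theorem weight_three : weight 3 = 2 := rfl

/-- `A` is a union of connected components of the subgraph induced by `C`. -/
def IsPart {V : Type u} (G : SimpleGraph V) (C A : Finset V) : Prop :=
  A ⊆ C ∧ ∀ a ∈ A, ∀ b ∈ C, G.Adj a b → b ∈ A

/-- The subgraph induced by `S` is connected. -/
def ConnIn {V : Type u} (G : SimpleGraph V) (S : Finset V) : Prop :=
  S.Nonempty ∧ ∀ A, IsPart G S A → A.Nonempty → A = S

/-- `M` meets every connected component of the subgraph induced by `C`. -/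
def Transversal {V : Type u} (G : SimpleGraph V) (C M : Finset V) : Prop :=
  ∀ A, IsPart G C A → A.Nonempty → ∃ m ∈ M, m ∈ A

/-- The total weight of `C` with respect to the degrees in `S`, plus the number of edges
between `C` and the rest of `S`. -/
def boundaryWeight {V : Type u} (G : SimpleGraph V) [DecidableRel G.Adj] (S C : Finset V) : ℤ :=
  ∑ a ∈ C, (weight (degIn G S a) + degIn G S a - degIn G C a)

/-! ### Unions of components, boundary weights and transversals -/

section

variable {V : Type u} {G : SimpleGraph V}

theorem IsPart.trans {C A B : Finset V} (hA : IsPart G C A) (hB : IsPart G A B) :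
    IsPart G C B :=
  ⟨hB.1.trans hA.1, fun a ha b hb hab => hB.2 a ha b (hA.2 a (hB.1 ha) b hb hab) hab⟩

theorem IsPart.sdiff [DecidableEq V] {C A : Finset V} (hA : IsPart G C A) :
    IsPart G C (C \ A) := by
  refine ⟨Finset.sdiff_subset, fun a ha b hb hab => ?_⟩
  rw [Finset.mem_sdiff] at ha ⊢
  exact ⟨hb, fun h => ha.2 (hA.2 b h a ha.1 hab.symm)⟩

theorem degIn_mono [DecidableRel G.Adj] {A C : Finset V} (h : A ⊆ C) (a : V) :
    degIn G A a ≤ degIn G C a :=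
  Finset.card_le_card (Finset.filter_subset_filter _ h)

theorem IsPart.degIn_eq [DecidableRel G.Adj] {C A : Finset V} (hA : IsPart G C A) {a : V}
    (ha : a ∈ A) : degIn G A a = degIn G C a := by
  unfold degIn
  congr 1
  ext b
  simp only [Finset.mem_filter]
  exact ⟨fun h => ⟨hA.1 h.1, h.2⟩, fun h => ⟨hA.2 a ha b h.1 h.2, h.2⟩⟩

theorem IsPart.boundaryWeight_eq [DecidableEq V] [DecidableRel G.Adj] {C A : Finset V}
    (hA : IsPart G C A) (S : Finset V) :
    boundaryWeight G S C = boundaryWeight G S A + boundaryWeight G S (C \ A) := by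
  unfold boundaryWeight
  rw [← Finset.sum_sdiff hA.1, add_comm]
  congr 1
  · exact Finset.sum_congr rfl fun a ha => by rw [hA.degIn_eq ha]
  · exact Finset.sum_congr rfl fun a ha => by rw [hA.sdiff.degIn_eq ha]

theorem degIn_erase [DecidableEq V] [DecidableRel G.Adj] {C : Finset V} {z : V} (hz : z ∈ C)
    (a : V) : (degIn G (C.erase z) a : ℤ) = degIn G C a - if G.Adj a z then 1 else 0 := by
  unfold degIn
  rw [Finset.filter_erase]
  split_ifs with h
  · rw [Finset.cast_card_erase_of_mem (by simp [hz, h])]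
  · rw [Finset.erase_eq_of_notMem (by simp [h])]
    simp

theorem degIn_erase_self [DecidableEq V] [DecidableRel G.Adj] (C : Finset V) (z : V) :
    degIn G (C.erase z) z = degIn G C z := by
  unfold degIn
  rw [Finset.filter_erase, Finset.erase_eq_of_notMem (by simp)]

/-- Removing `z` takes away its weight and its boundary edges, and turns its edges inside `C` into
boundary edges. -/
theorem boundaryWeight_erase [DecidableEq V] [DecidableRel G.Adj] (S : Finset V) {C : Finset V}
    {z : V} (hz : z ∈ C) :
    boundaryWeight G S (C.erase z) =
      boundaryWeight G S C - weight (degIn G S z) - degIn G S z + 2 * degIn G C z := by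
  have h1 : (degIn G C z : ℤ) = ∑ a ∈ C.erase z, if G.Adj a z then (1 : ℤ) else 0 := by
    rw [← degIn_erase_self, Finset.sum_boole, degIn]
    simp only [G.adj_comm]
  unfold boundaryWeight
  rw [← Finset.add_sum_erase C _ hz]
  have h2 : ∑ a ∈ C.erase z, (weight (degIn G S a) + degIn G S a - degIn G (C.erase z) a) =
      ∑ a ∈ C.erase z, (weight (degIn G S a) + degIn G S a - degIn G C a) + degIn G C z := by
    rw [h1, ← Finset.sum_add_distrib]
    exact Finset.sum_congr rfl fun a _ => by rw [degIn_erase hz]; ring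
  rw [h2]
  ring

theorem boundaryWeight_self [DecidableRel G.Adj] (S : Finset V) :
    boundaryWeight G S S = ∑ a ∈ S, weight (degIn G S a) :=
  Finset.sum_congr rfl fun a _ => by ring

/-- Every vertex belongs to a transversal of the same size as a given one. -/
theorem Transversal.exists_mem_swap [DecidableEq V] {C M : Finset V} (hM : Transversal G C M)
    {z : V} (hz : z ∈ C) : ∃ M', Transversal G C M' ∧ z ∈ M' ∧ M'.card ≤ M.card := by
  -- Some `m` can be traded for `z`: every part that only `m` hits contains `z`. Otherwise each `m`
  -- has such a part avoiding `z`; the complement of their union contains `z`, so it is hit by some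
  -- `m`, which however lies in its own part.
  obtain ⟨m, hm, h⟩ : ∃ m ∈ M, ∀ A, IsPart G C A → A.Nonempty → (∀ x ∈ M, x ∈ A → x = m) →
      z ∈ A := by
    by_contra! hcon
    choose! A hA hne hmA hzA using hcon
    have hB : IsPart G C (M.biUnion A) := by
      refine ⟨Finset.biUnion_subset.2 fun m hm => (hA m hm).1, fun a ha b hb hab => ?_⟩
      obtain ⟨m, hm, ham⟩ := Finset.mem_biUnion.1 ha
      exact Finset.mem_biUnion.2 ⟨m, hm, (hA m hm).2 a ham b hb hab⟩
    obtain ⟨m, hm, hmB⟩ := hM _ hB.sdiff ⟨z, by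
      simp only [Finset.mem_sdiff, Finset.mem_biUnion, not_exists, not_and]
      exact ⟨hz, fun m hm => hzA m hm⟩⟩
    refine (Finset.mem_sdiff.1 hmB).2 (Finset.mem_biUnion.2 ⟨m, hm, ?_⟩)
    obtain ⟨x, hx, hxA⟩ := hM _ (hA m hm) (hne m hm)
    rwa [hmA m hm x hx hxA] at hxA
  refine ⟨insert z (M.erase m), fun A hA hne => ?_, Finset.mem_insert_self _ _, ?_⟩
  · by_cases hzA : z ∈ A
    · exact ⟨z, Finset.mem_insert_self _ _, hzA⟩
    · by_contra! hcon
      refine hzA (h A hA hne fun x hx hxA => ?_)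
      by_contra hxm
      exact hcon x (Finset.mem_insert_of_mem (Finset.mem_erase.2 ⟨hxm, hx⟩)) hxA
  · refine (Finset.card_insert_le _ _).trans ?_
    rw [Finset.card_erase_of_mem hm]
    have := Finset.card_pos.2 ⟨m, hm⟩
    omega

/-- Deleting a vertex of degree `d` creates at most `d - 1` new components. -/
theorem Transversal.exists_erase [DecidableEq V] [DecidableRel G.Adj] {C M : Finset V}
    (hM : Transversal G C M) {z : V} (hz : z ∈ C) :
    ∃ M', Transversal G (C.erase z) M' ∧ M'.card + 1 ≤ M.card + degIn G C z := by
  obtain ⟨N, hN, hzN, hcard⟩ := hM.exists_mem_swap hz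
  -- A part of `C.erase z` that contains no neighbour of `z` is already a part of `C`, so `N` hits
  -- it, and not in `z`.
  refine ⟨N.erase z ∪ C.filter (G.Adj z), fun A hA hne => ?_, ?_⟩
  · by_contra! hcon
    have hA' : IsPart G C A := by
      refine ⟨hA.1.trans (Finset.erase_subset _ _), fun a ha b hb hab => ?_⟩
      refine hA.2 a ha b (Finset.mem_erase.2 ⟨?_, hb⟩) hab
      rintro rfl
      exact hcon a (Finset.mem_union_right _ (Finset.mem_filter.2
        ⟨Finset.mem_of_mem_erase (hA.1 ha), hab.symm⟩)) ha
    obtain ⟨m, hm, hmA⟩ := hN A hA' hne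
    exact hcon m (Finset.mem_union_left _ (Finset.mem_erase.2
      ⟨Finset.ne_of_mem_erase (hA.1 hmA), hm⟩)) hmA
  · have h1 := Finset.card_union_le (N.erase z) (C.filter (G.Adj z))
    rw [Finset.card_erase_of_mem hzN] at h1
    have h2 := Finset.card_pos.2 ⟨z, hzN⟩
    unfold degIn
    omega

theorem ConnIn.transversal {S : Finset V} (hS : ConnIn G S) {x : V} (hx : x ∈ S) :
    Transversal G S {x} := fun A hA hne =>
  ⟨x, Finset.mem_singleton_self x, hS.2 A hA hne ▸ hx⟩

/-- Independent sets of the components of a disconnected induced subgraph can be combined. -/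
theorem exists_indep_of_transversal [DecidableEq V] [DecidableRel G.Adj] {S : Finset V}
    (ih : ∀ A, A ⊂ S → ConnIn G A →
      ∃ I ⊆ A, G.IsIndepSet I ∧ boundaryWeight G S A - 2 ≤ 7 * (I.card : ℤ))
    (C M : Finset V) (hC : C ⊂ S) (hM : Transversal G C M) :
    ∃ I ⊆ C, G.IsIndepSet I ∧ boundaryWeight G S C - 2 * M.card ≤ 7 * (I.card : ℤ) := by
  induction C using Finset.strongInduction generalizing M with
  | H C IH =>
    rcases C.eq_empty_or_nonempty with rfl | hne
    · exact ⟨∅, subset_rfl, by simp, by simp [boundaryWeight]⟩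
    by_cases hconn : ConnIn G C
    · obtain ⟨I, hI, hind, hcard⟩ := ih C hC hconn
      obtain ⟨m, hm, -⟩ := hM C ⟨subset_rfl, fun _ _ _ hb _ => hb⟩ hne
      have := Finset.card_pos.2 ⟨m, hm⟩
      exact ⟨I, hI, hind, by omega⟩
    · obtain ⟨A, hA, hAne, hAC⟩ : ∃ A, IsPart G C A ∧ A.Nonempty ∧ A ≠ C := by
        unfold ConnIn at hconn
        push Not at hconn
        exact hconn hne
      have hssub : A ⊂ C := Finset.ssubset_iff_subset_ne.2 ⟨hA.1, hAC⟩
      have hssub' : C \ A ⊂ C := Finset.sdiff_ssubset hA.1 hAne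
      have key : ∀ B, IsPart G C B → Transversal G B (M ∩ B) := fun B hB D hD hDne => by
        obtain ⟨m, hm, hmD⟩ := hM D (hB.trans hD) hDne
        exact ⟨m, Finset.mem_inter.2 ⟨hm, hD.1 hmD⟩, hmD⟩
      obtain ⟨I, hI, hind, hcard⟩ := IH A hssub _ (hssub.trans hC) (key A hA)
      obtain ⟨J, hJ, hind', hcard'⟩ := IH _ hssub' _ (hssub'.trans hC) (key _ hA.sdiff)
      have hdisj : Disjoint I J :=
        Finset.disjoint_of_subset_left hI (Finset.disjoint_of_subset_right hJ
          Finset.disjoint_sdiff)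
      refine ⟨I ∪ J, Finset.union_subset (hI.trans hA.1) (hJ.trans Finset.sdiff_subset), ?_, ?_⟩
      · have hcross : ∀ a ∈ I, ∀ b ∈ J, ¬ G.Adj a b := fun a ha b hb hab =>
          (Finset.mem_sdiff.1 (hJ hb)).2
            (hA.2 a (hI ha) b (Finset.mem_sdiff.1 (hJ hb)).1 hab)
        intro a ha b hb hab
        rcases Finset.mem_union.1 ha with ha | ha <;> rcases Finset.mem_union.1 hb with hb | hb
        · exact hind ha hb hab
        · exact hcross a ha b hb
        · exact fun h => hcross b hb a ha h.symm
        · exact hind' ha hb hab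
      · have h1 : (M ∩ A).card + (M ∩ (C \ A)).card ≤ M.card := by
          rw [← Finset.card_union_of_disjoint]
          · exact Finset.card_le_card (Finset.union_subset Finset.inter_subset_left
              Finset.inter_subset_left)
          · exact Finset.disjoint_of_subset_left Finset.inter_subset_right
              (Finset.disjoint_of_subset_right Finset.inter_subset_right Finset.disjoint_sdiff)
        rw [hA.boundaryWeight_eq, Finset.card_union_of_disjoint hdisj]
        push_cast
        omega

/-! ### Non-cut vertices -/

/-- A connected graph on at least two vertices has a vertex that is not a cut vertex. -/
theorem ConnIn.exists_erase [DecidableEq V] {S : Finset V} (hS : ConnIn G S)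
    (hcard : 2 ≤ S.card) : ∃ v ∈ S, ConnIn G (S.erase v) := by
  classical
  obtain ⟨s, hs⟩ := hS.1
  have hsing : {s} ∈ S.powerset.filter (fun A => ConnIn G A ∧ A ≠ S) := by
    simp only [Finset.mem_filter, Finset.mem_powerset, Finset.singleton_subset_iff]
    refine ⟨hs, ⟨⟨s, by simp⟩, fun A hA hne => ?_⟩, fun h => ?_⟩
    · exact (Finset.subset_singleton_iff.1 hA.1).resolve_left hne.ne_empty
    · rw [← h] at hcard
      simp at hcard
  -- A largest connected proper subset misses only one vertex: adding an adjacent outside vertex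
  -- keeps it connected, so the result must be all of `S`.
  obtain ⟨A, hA, hmax⟩ := Finset.exists_max_image _ Finset.card ⟨_, hsing⟩
  simp only [Finset.mem_filter, Finset.mem_powerset] at hA hmax
  obtain ⟨hAS, hAconn, hAne⟩ := hA
  obtain ⟨a, ha, b, hb, hab, hbA⟩ : ∃ a ∈ A, ∃ b ∈ S, G.Adj a b ∧ b ∉ A := by
    by_contra! hcon
    exact hAne (hS.2 A ⟨hAS, hcon⟩ hAconn.1)
  have hins : ConnIn G (insert b A) := by
    refine ⟨⟨b, by simp⟩, fun B hB hne => ?_⟩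
    have hBA : IsPart G A (B ∩ A) := by
      refine ⟨Finset.inter_subset_right, fun x hx y hy hxy => ?_⟩
      rw [Finset.mem_inter] at hx ⊢
      exact ⟨hB.2 x hx.1 y (Finset.mem_insert_of_mem hy) hxy, hy⟩
    have haB : a ∈ B := by
      rcases (B ∩ A).eq_empty_or_nonempty with h | h
      · obtain ⟨c, hc⟩ := hne
        rcases Finset.mem_insert.1 (hB.1 hc) with rfl | hcA
        · exact hB.2 c hc a (Finset.mem_insert_of_mem ha) hab.symm
        · exact absurd (Finset.mem_inter.2 ⟨hc, hcA⟩) (by simp [h])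
      · have := hAconn.2 _ hBA h
        rw [← this] at ha
        exact (Finset.mem_inter.1 ha).1
    have hAB := hAconn.2 _ hBA ⟨a, Finset.mem_inter.2 ⟨haB, ha⟩⟩
    refine hB.1.antisymm (Finset.insert_subset (hB.2 a haB b (by simp) hab) ?_)
    rw [← hAB]
    exact Finset.inter_subset_left
  refine ⟨b, hb, ?_⟩
  have hSeq : insert b A = S := by
    by_contra hne
    have := hmax _ ⟨Finset.insert_subset hb hAS, hins, hne⟩
    rw [Finset.card_insert_of_notMem hbA] at this
    omega
  rwa [← hSeq, Finset.erase_insert hbA]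

/-! ### The induction for the lower bound -/

theorem weight_add_le {m n : ℕ} (hmn : m ≤ n) (hn : n ≤ 3) :
    weight n + n - m ≤ weight m := by
  interval_cases n <;> interval_cases m <;> simp [weight]

theorem ConnIn.degIn_pos [DecidableRel G.Adj] {S : Finset V} (hS : ConnIn G S)
    (hcard : 2 ≤ S.card) {v : V} (hv : v ∈ S) : 1 ≤ degIn G S v := by
  by_contra h
  have h0 : S.filter (G.Adj v) = ∅ := Finset.card_eq_zero.1 (by unfold degIn at h; omega)
  have hp : IsPart G S {v} := by
    refine ⟨by simpa using hv, fun a ha b hb hab => ?_⟩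
    rw [Finset.mem_singleton.1 ha] at hab
    exact absurd (Finset.mem_filter.2 ⟨hb, hab⟩) (by simp [h0])
  have := hS.2 _ hp ⟨v, by simp⟩
  rw [← this] at hcard
  simp at hcard

theorem degIn_lt_card [DecidableRel G.Adj] {S : Finset V} {v : V} (hv : v ∈ S) :
    degIn G S v < S.card :=
  Finset.card_lt_card (Finset.ssubset_iff_subset_ne.2
    ⟨Finset.filter_subset _ _, fun h => by rw [← h] at hv; simp at hv⟩)

/-- A bound for a connected proper part in terms of its own degrees, rewritten in terms of the
degrees in the whole. -/
theorem boundaryWeight_le_of_conn [DecidableRel G.Adj] {S A : Finset V}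
    (hS : ConnIn G S) (hdeg : ∀ v ∈ S, degIn G S v ≤ 3) (hAS : A ⊂ S) (hA : ConnIn G A) :
    boundaryWeight G S A ≤
      ∑ a ∈ A, weight (degIn G A a) - if A.card = 2 then 1 else 0 := by
  classical
  have hle : ∀ a ∈ A, weight (degIn G S a) + degIn G S a - degIn G A a ≤ weight (degIn G A a) :=
    fun a ha => weight_add_le (degIn_mono hAS.1 a) (hdeg a (hAS.1 ha))
  split_ifs with h2
  · rw [Int.le_sub_one_iff]
    refine Finset.sum_lt_sum hle ?_
    by_contra! hcon
    -- For K₂ the extra 1 comes from strictness: an endpoint with an edge leaving `A` drops from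
    -- degree 2 or 3 to degree 1, where `weight n + n - 1 = 4 < 5`. Without such an edge `A` would
    -- be all of `S`.
    have hpart : IsPart G S A := by
      refine ⟨hAS.1, fun a ha b hb hab => ?_⟩
      by_contra hbA
      have h1 := hA.degIn_pos (by omega) ha
      have h3 := degIn_lt_card (G := G) ha
      have h4 : degIn G A a < degIn G S a := Finset.card_lt_card
        (Finset.ssubset_iff_of_subset (Finset.filter_subset_filter _ hAS.1) |>.2
          ⟨b, by simp [hb, hab], by simp [hbA]⟩)
      have h5 := hcon a ha
      have h6 := hdeg a (hAS.1 ha)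
      have h7 : degIn G A a = 1 := by omega
      rw [h7] at h4 h5
      generalize degIn G S a = d at *
      interval_cases d <;> simp [weight] at h5
    exact hAS.ne (hS.2 A hpart hA.1)
  · simpa [boundaryWeight] using Finset.sum_le_sum hle

theorem isIndepSet_insert_of_neighbors_deleted [DecidableEq V] [DecidableRel G.Adj]
    {D I : Finset V} {v : V} (hI : I ⊆ D) (hind : G.IsIndepSet I)
    (hN : ∀ x ∈ D, ¬ G.Adj v x) : G.IsIndepSet (insert v I : Finset V) := by
  intro a ha b hb hab
  rw [Finset.mem_coe, Finset.mem_insert] at ha hb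
  rcases ha with rfl | ha <;> rcases hb with rfl | hb
  · exact absurd rfl hab
  · exact hN b (hI hb)
  · exact fun h => hN a (hI ha) h.symm
  · exact hind ha hb hab

theorem weight_add_of_two_le {d : ℕ} (h : 2 ≤ d) (h' : d ≤ 3) : weight d + d = 5 := by
  interval_cases d <;> simp [weight]

/-- Any connected induced subgraph of maximum degree at most three contains a large independent
set. -/
theorem exists_indep_of_conn [DecidableEq V] [DecidableRel G.Adj] (S : Finset V)
    (hS : ConnIn G S) (hdeg : ∀ v ∈ S, degIn G S v ≤ 3) :
    ∃ I ⊆ S, G.IsIndepSet I ∧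
      ∑ a ∈ S, weight (degIn G S a) - 2 - (if S.card = 2 then 1 else 0) ≤ 7 * (I.card : ℤ) := by
  induction S using Finset.strongInduction with
  | H S IH =>
    have ih : ∀ A, A ⊂ S → ConnIn G A →
        ∃ I ⊆ A, G.IsIndepSet I ∧ boundaryWeight G S A - 2 ≤ 7 * (I.card : ℤ) := by
      intro A hAS hA
      obtain ⟨I, hI, hind, hcard⟩ :=
        IH A hAS hA fun v hv => (degIn_mono hAS.1 v).trans (hdeg v (hAS.1 hv))
      have := boundaryWeight_le_of_conn hS hdeg hAS hA
      exact ⟨I, hI, hind, by omega⟩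
    obtain ⟨s, hs⟩ := hS.1
    have hpos := Finset.card_pos.2 hS.1
    by_cases hsmall : S.card ≤ 2
    · refine ⟨{s}, by simpa using hs, by simp, ?_⟩
      have hdeg1 : ∀ a ∈ S, degIn G S a = S.card - 1 := fun a ha => by
        have h1 := degIn_lt_card (G := G) ha
        by_cases h2 : S.card = 2
        · have := hS.degIn_pos h2.ge ha
          omega
        · omega
      rw [Finset.sum_congr rfl fun a ha => by rw [hdeg1 a ha], Finset.sum_const, nsmul_eq_mul,
        Finset.card_singleton]
      generalize S.card = k at *
      interval_cases k <;> simp [weight]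
    obtain ⟨v, hv, hconn⟩ := hS.exists_erase (by omega)
    have hcardv : (S.erase v).card = S.card - 1 := Finset.card_erase_of_mem hv
    have hvS : S.erase v ⊂ S := Finset.erase_ssubset hv
    have hbv := boundaryWeight_erase (G := G) S hv
    rw [boundaryWeight_self] at hbv
    rw [if_neg (by omega)]
    have hd1 := hS.degIn_pos (by omega) hv
    have hd3 := hdeg v hv
    -- This is where the choice of a non-cut vertex matters: besides `v`, the vertex `x` has another
    -- neighbour in the connected rest.
    have hnb : ∀ x ∈ S, G.Adj v x → 2 ≤ degIn G S x := fun x hx hvx => by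
      have h1 := hconn.degIn_pos (by omega) (Finset.mem_erase.2 ⟨hvx.ne', hx⟩)
      have h2 := degIn_erase (G := G) hv x
      rw [if_pos hvx.symm] at h2
      omega
    obtain h | h | h : degIn G S v = 1 ∨ degIn G S v = 2 ∨ degIn G S v = 3 := by omega
    · obtain ⟨x, hx⟩ := Finset.card_eq_one.1 h
      have hxm : x ∈ S ∧ G.Adj v x := Finset.mem_filter.1 (by rw [hx]; simp)
      have hxC : x ∈ S.erase v := Finset.mem_erase.2 ⟨hxm.2.ne', hxm.1⟩
      -- With W the total weight, `boundaryWeight` minus twice the transversal size is W - 6 after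
      -- deleting `v` and at most 3 less after deleting `x`. Adding 7 for `v` returns W - 2.
      obtain ⟨M, hM, hMc⟩ := (hconn.transversal hxC).exists_erase hxC
      have hsub : (S.erase v).erase x ⊆ S.erase v := Finset.erase_subset _ _
      obtain ⟨I, hI, hind, hcard⟩ := exists_indep_of_transversal ih _ M
        (Finset.ssubset_of_subset_of_ssubset hsub hvS) hM
      have hvI : v ∉ I := fun hvI => by simpa using hI hvI
      refine ⟨insert v I, Finset.insert_subset hv ((hI.trans hsub).trans hvS.1),
        isIndepSet_insert_of_neighbors_deleted hI hind ?_, ?_⟩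
      · intro y hy hvy
        have : y ∈ S.filter (G.Adj v) := Finset.mem_filter.2 ⟨hvS.1 (hsub hy), hvy⟩
        rw [hx, Finset.mem_singleton] at this
        simp [this] at hy
      · rw [Finset.card_insert_of_notMem hvI]
        rw [boundaryWeight_erase S hxC] at hcard
        have hw := weight_add_of_two_le (hnb x hxm.1 hxm.2) (hdeg x hxm.1)
        rw [h] at hbv
        simp only [weight_one, Finset.card_singleton] at hbv hMc
        push_cast
        omega
    · obtain ⟨x, y, hxy, hx⟩ := Finset.card_eq_two.1 h
      have hxm : x ∈ S ∧ G.Adj v x := Finset.mem_filter.1 (by rw [hx]; simp)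
      have hym : y ∈ S ∧ G.Adj v y := Finset.mem_filter.1 (by rw [hx]; simp)
      have hxC : x ∈ S.erase v := Finset.mem_erase.2 ⟨hxm.2.ne', hxm.1⟩
      have hyC : y ∈ (S.erase v).erase x :=
        Finset.mem_erase.2 ⟨hxy.symm, Finset.mem_erase.2 ⟨hym.2.ne', hym.1⟩⟩
      -- Here deleting `v` leaves W - 3 and each of `x`, `y` costs at most 3; again 7 for `v`
      -- returns W - 2. This does not depend on whether `x` and `y` are adjacent.
      obtain ⟨M, hM, hMc⟩ := (hconn.transversal hxC).exists_erase hxC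
      obtain ⟨N, hN, hNc⟩ := hM.exists_erase hyC
      have hsub : ((S.erase v).erase x).erase y ⊆ S.erase v :=
        (Finset.erase_subset _ _).trans (Finset.erase_subset _ _)
      obtain ⟨I, hI, hind, hcard⟩ := exists_indep_of_transversal ih _ N
        (Finset.ssubset_of_subset_of_ssubset hsub hvS) hN
      have hvI : v ∉ I := fun hvI => by simpa using hI hvI
      refine ⟨insert v I, Finset.insert_subset hv ((hI.trans hsub).trans hvS.1),
        isIndepSet_insert_of_neighbors_deleted hI hind ?_, ?_⟩
      · intro z hz hvz
        have : z ∈ S.filter (G.Adj v) := Finset.mem_filter.2 ⟨hvS.1 (hsub hz), hvz⟩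
        rw [hx, Finset.mem_insert, Finset.mem_singleton] at this
        rcases this with rfl | rfl <;> simp at hz
      · rw [Finset.card_insert_of_notMem hvI]
        rw [boundaryWeight_erase S hyC, boundaryWeight_erase S hxC] at hcard
        have hw := weight_add_of_two_le (hnb x hxm.1 hxm.2) (hdeg x hxm.1)
        have hw' := weight_add_of_two_le (hnb y hym.1 hym.2) (hdeg y hym.1)
        rw [h] at hbv
        simp only [weight_two, Finset.card_singleton] at hbv hMc
        push_cast
        omega
    -- Three new boundary edges outweigh the lost weight 2, so `v` need not be used.
    · obtain ⟨I, hI, hind, hcard⟩ := ih _ hvS hconn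
      refine ⟨I, hI.trans hvS.1, hind, ?_⟩
      rw [h] at hbv
      rw [weight_three] at hbv
      omega

end

/-! ### From weights to degree counts -/

/-- The coefficient of a vertex of given degree in the lower bound. -/
def degreeValue : ℕ → ℕ
  | 1 => 5
  | 2 => 3
  | 3 => 2
  | _ => 0

/-- The sum of the coefficients of all vertices. -/
def degreeWeight {V : Type*} [Fintype V] (G : SimpleGraph V) [DecidableRel G.Adj] : ℕ :=
  ∑ v, degreeValue (G.degree v)

theorem degreeWeight_eq {V : Type u} [Fintype V] (G : SimpleGraph V) [DecidableRel G.Adj] :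
    degreeWeight G =
      5 * (degreeClass G 1).card + 3 * (degreeClass G 2).card + 2 * (degreeClass G 3).card := by
  unfold degreeWeight degreeClass
  simp only [Finset.card_filter, Finset.mul_sum]
  rw [← Finset.sum_add_distrib, ← Finset.sum_add_distrib]
  refine Finset.sum_congr rfl fun a _ => ?_
  generalize G.degree a = d
  rcases d with _ | _ | _ | _ | d <;> simp [degreeValue]

theorem degreeValue_le_weight (d : ℕ) : (degreeValue d : ℤ) ≤ weight d := by
  rcases d with _ | _ | _ | _ | d <;> simp [degreeValue, weight]

theorem degreeWeight_le {V : Type u} [Fintype V] (G : SimpleGraph V) [DecidableRel G.Adj]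
    (hconn : G.Connected) (hdeg : G.maxDegree ≤ 3) (hcard : 3 ≤ Fintype.card V) :
    degreeWeight G ≤ 7 * G.indepNum + 2 := by
  classical
  have hd : ∀ v, degIn G Finset.univ v = G.degree v := fun v => by
    rw [degIn, ← G.card_neighborFinset_eq_degree, G.neighborFinset_eq_filter]
  have hC : ConnIn G Finset.univ := by
    have := hconn.nonempty
    refine ⟨Finset.univ_nonempty, fun A hA ⟨a, ha⟩ => Finset.eq_univ_iff_forall.2 fun b => ?_⟩
    by_contra hb
    obtain ⟨p⟩ := hconn.preconnected a b
    obtain ⟨d, -, h1, h2⟩ := p.exists_boundary_dart (A : Set V) ha hb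
    exact h2 (hA.2 _ h1 _ (Finset.mem_univ _) d.adj)
  obtain ⟨I, -, hind, hI⟩ := exists_indep_of_conn Finset.univ hC fun v _ => by
    rw [hd]
    exact (G.degree_le_maxDegree v).trans hdeg
  have hle := hind.card_le_indepNum
  rw [Finset.card_univ, if_neg (by omega)] at hI
  have hsum : (degreeWeight G : ℤ) ≤ ∑ a, weight (degIn G Finset.univ a) := by
    unfold degreeWeight
    push_cast
    exact Finset.sum_le_sum fun a _ => by
      rw [hd]
      exact degreeValue_le_weight _
  omega

/-! ### Equality for the class 𝒜 -/

theorem degree_eq_sum_adj {V : Type*} [Fintype V] (G : SimpleGraph V) [DecidableRel G.Adj]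
    (v : V) : G.degree v = ∑ w, if G.Adj v w then 1 else 0 := by
  rw [← G.card_neighborFinset_eq_degree, G.neighborFinset_eq_filter, Finset.card_filter]

theorem degreeWeight_congr {V W : Type*} [Fintype V] [Fintype W] {G : SimpleGraph V}
    {H : SimpleGraph W} [DecidableRel G.Adj] [DecidableRel H.Adj] (e : G ≃g H) :
    degreeWeight G = degreeWeight H :=
  Fintype.sum_equiv e.toEquiv _ _ fun v => congrArg degreeValue (e.degree_eq v).symm

theorem indepNum_le_of_iso {V W : Type*} [Finite W] {G : SimpleGraph V}
    {H : SimpleGraph W} (e : G ≃g H) : G.indepNum ≤ H.indepNum := by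
  have := Finite.of_equiv W e.symm.toEquiv
  obtain ⟨s, hs⟩ := G.exists_isNIndepSet_indepNum
  rw [← hs.card_eq, ← Finset.card_map e.toEquiv.toEmbedding]
  refine SimpleGraph.IsIndepSet.card_le_indepNum ?_
  intro a ha b hb hab
  simp only [Finset.coe_map, Set.mem_image] at ha hb
  obtain ⟨a, ha, rfl⟩ := ha
  obtain ⟨b, hb, rfl⟩ := hb
  exact fun h => hs.isIndepSet ha hb (fun h' => hab (by rw [h'])) (e.map_adj_iff.1 h)

theorem indepNum_congr {V W : Type*} [Finite V] [Finite W] {G : SimpleGraph V}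
    {H : SimpleGraph W} (e : G ≃g H) : G.indepNum = H.indepNum :=
  (indepNum_le_of_iso e).antisymm (indepNum_le_of_iso e.symm)

section

variable {V : Type*} {G : SimpleGraph V} {x : V} {w : Fin 3}

theorem addTriangle_adj_inl_inl {a b : V} :
    (addTriangle G x w).Adj (.inl a) (.inl b) ↔ G.Adj a b := by
  simp [addTriangle, SimpleGraph.edge_adj]

theorem addTriangle_adj_inl_inr {a : V} {i : Fin 3} :
    (addTriangle G x w).Adj (.inl a) (.inr i) ↔ a = x ∧ i = w := by
  simp [addTriangle, SimpleGraph.edge_adj]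

theorem addTriangle_adj_inr_inl {a : V} {i : Fin 3} :
    (addTriangle G x w).Adj (.inr i) (.inl a) ↔ a = x ∧ i = w := by
  rw [SimpleGraph.adj_comm, addTriangle_adj_inl_inr]

theorem addTriangle_adj_inr_inr {i j : Fin 3} :
    (addTriangle G x w).Adj (.inr i) (.inr j) ↔ i ≠ j := by
  simp [addTriangle, SimpleGraph.edge_adj]

theorem indepNum_addTriangle [Finite V] :
    (addTriangle G x w).indepNum = G.indepNum + 1 := by
  apply le_antisymm
  · obtain ⟨s, hs⟩ := (addTriangle G x w).exists_isNIndepSet_indepNum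
    rw [← hs.card_eq, ← Finset.card_toLeft_add_card_toRight]
    refine Nat.add_le_add (SimpleGraph.IsIndepSet.card_le_indepNum ?_)
      (Finset.card_le_one.2 fun i hi j hj => ?_)
    · intro a ha b hb hab h
      exact hs.isIndepSet (Finset.mem_toLeft.1 ha) (Finset.mem_toLeft.1 hb) (by simpa using hab)
        (addTriangle_adj_inl_inl.2 h)
    · by_contra hij
      exact hs.isIndepSet (Finset.mem_toRight.1 hi) (Finset.mem_toRight.1 hj)
        (by simpa using hij) (addTriangle_adj_inr_inr.2 hij)
  · obtain ⟨s, hs⟩ := G.exists_isNIndepSet_indepNum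
    -- A triangle vertex other than `w` has no neighbour in `G`, so it extends any independent set.
    obtain ⟨i, hi⟩ := exists_ne w
    have hcard : (s.disjSum {i}).card = G.indepNum + 1 := by
      rw [Finset.card_disjSum, hs.card_eq, Finset.card_singleton]
    rw [← hcard]
    refine SimpleGraph.IsIndepSet.card_le_indepNum ?_
    rintro (a | a) ha (b | b) hb hab
    · rw [addTriangle_adj_inl_inl]
      exact hs.isIndepSet (by simpa using ha) (by simpa using hb) (by simpa using hab)
    · rw [addTriangle_adj_inl_inr]
      rintro ⟨-, rfl⟩
      exact hi (by simpa [eq_comm] using hb)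
    · rw [addTriangle_adj_inr_inl]
      rintro ⟨-, rfl⟩
      exact hi (by simpa [eq_comm] using ha)
    · have ha' : a = i := by simpa using ha
      have hb' : b = i := by simpa using hb
      exact absurd (by rw [ha', hb']) hab

theorem degree_addTriangle_inl [Fintype V] [DecidableEq V] [DecidableRel G.Adj]
    [DecidableRel (addTriangle G x w).Adj] (a : V) :
    (addTriangle G x w).degree (.inl a) = G.degree a + if a = x then 1 else 0 := by
  rw [degree_eq_sum_adj, degree_eq_sum_adj, Fintype.sum_sum_type]
  simp only [addTriangle_adj_inl_inl, addTriangle_adj_inl_inr]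
  split_ifs with h <;> simp [h]

theorem degree_addTriangle_inr [Fintype V] [DecidableEq V]
    [DecidableRel (addTriangle G x w).Adj] (i : Fin 3) :
    (addTriangle G x w).degree (.inr i) = 2 + if i = w then 1 else 0 := by
  rw [degree_eq_sum_adj, Fintype.sum_sum_type, add_comm]
  simp only [addTriangle_adj_inr_inl, addTriangle_adj_inr_inr]
  congr 1
  · fin_cases i <;> simp [Fin.sum_univ_three]
  · split_ifs with h <;> simp [h]

/-- The triangle has degrees 3, 2, 2 and contributes 8; `x` passes from degree 2 to 3 and loses 1.
-/
theorem degreeWeight_addTriangle [Fintype V] [DecidableRel G.Adj]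
    [DecidableRel (addTriangle G x w).Adj] (hx : G.degree x = 2) :
    degreeWeight (addTriangle G x w) = degreeWeight G + 7 := by
  classical
  unfold degreeWeight
  rw [Fintype.sum_sum_type]
  simp only [degree_addTriangle_inl, degree_addTriangle_inr]
  have h1 : ∑ i : Fin 3, degreeValue (2 + if i = w then 1 else 0) = 8 := by
    fin_cases w <;> simp [Fin.sum_univ_three, degreeValue]
  rw [h1, ← Finset.add_sum_erase _ _ (Finset.mem_univ x),
    ← Finset.add_sum_erase (a := x) (f := fun v => degreeValue (G.degree v)) _
      (Finset.mem_univ x), hx]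
  have h2 : ∑ a ∈ Finset.univ.erase x, degreeValue (G.degree a + if a = x then 1 else 0) =
      ∑ a ∈ Finset.univ.erase x, degreeValue (G.degree a) :=
    Finset.sum_congr rfl fun a ha => by rw [if_neg (Finset.ne_of_mem_erase ha), add_zero]
  rw [h2]
  simp only [if_true, degreeValue]
  omega

end

theorem ClassA.degreeWeight_eq {V : Type u} {G : SimpleGraph V} (hG : ClassA G) :
    ∀ [Fintype V] [DecidableRel G.Adj], degreeWeight G = 7 * G.indepNum + 2 := by
  classical
  induction hG with
  | triangle G e =>
    intro _ _
    have hind : (⊤ : SimpleGraph (Fin 3)).indepNum = 1 := by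
      apply le_antisymm
      · obtain ⟨s, hs⟩ := (⊤ : SimpleGraph (Fin 3)).exists_isNIndepSet_indepNum
        rw [← hs.card_eq]
        refine Finset.card_le_one.2 fun i hi j hj => ?_
        by_contra hij
        exact hs.isIndepSet hi hj hij hij
      · exact SimpleGraph.IsIndepSet.card_le_indepNum (t := {0}) (by simp)
    rw [degreeWeight_congr e, indepNum_congr e, hind]
    simp [degreeWeight, degreeValue]
  | @step V' _ G' _ x _ hx w G e ih =>
    intro _ _
    -- `ClassA` carries no finiteness for the smaller graph, so it is recovered from the larger one.
    have : Finite (V' ⊕ Fin 3) := Finite.of_equiv _ e.toEquiv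
    have : Finite V' := Finite.of_injective (Sum.inl : V' → V' ⊕ Fin 3) Sum.inl_injective
    have := Fintype.ofFinite V'
    rw [degreeWeight_congr e, indepNum_congr e, indepNum_addTriangle, degreeWeight_addTriangle,
      ih]
    · ring
    · convert hx

/-! ### Equality for the class ℬ -/

section

variable {V : Type*} [Fintype V] {G : SimpleGraph V}

/-- The pendant edges form a perfect matching, which gives the upper bound; the leaves attain it. -/
theorem indepNum_addPendants : (addPendants G).indepNum = Fintype.card V := by
  classical
  apply le_antisymm
  · obtain ⟨s, hs⟩ := (addPendants G).exists_isNIndepSet_indepNum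
    rw [← hs.card_eq, ← Finset.card_univ]
    refine Finset.card_le_card_of_injOn (Sum.elim id id) (fun _ _ => Finset.mem_univ _) ?_
    rintro (a | a) ha (b | b) hb hab
    · exact congrArg Sum.inl hab
    · exact absurd hab (hs.isIndepSet ha hb Sum.inl_ne_inr)
    · exact absurd hab (hs.isIndepSet ha hb Sum.inr_ne_inl)
    · exact congrArg Sum.inr hab
  · rw [← Finset.card_univ, ← Finset.card_map (Function.Embedding.inr : V ↪ V ⊕ V)]
    refine SimpleGraph.IsIndepSet.card_le_indepNum ?_
    rintro (a | a) ha (b | b) hb - h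
    · simp at ha
    · simp at ha
    · simp at hb
    · exact h

variable [DecidableRel (addPendants G).Adj]

theorem degree_addPendants_inl [DecidableRel G.Adj] (v : V) :
    (addPendants G).degree (.inl v) = G.degree v + 1 := by
  classical
  rw [degree_eq_sum_adj, degree_eq_sum_adj, Fintype.sum_sum_type]
  have h : ∀ w, (addPendants G).Adj (.inl v) (.inl w) ↔ G.Adj v w := fun _ => Iff.rfl
  have h' : ∀ w, (addPendants G).Adj (.inl v) (.inr w) ↔ v = w := fun _ => Iff.rfl
  simp only [h, h', Finset.sum_ite_eq, Finset.mem_univ, if_true]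

theorem degree_addPendants_inr (v : V) : (addPendants G).degree (.inr v) = 1 := by
  classical
  rw [degree_eq_sum_adj, Fintype.sum_sum_type]
  have h : ∀ w, (addPendants G).Adj (.inr v) (.inl w) ↔ v = w := fun _ => Iff.rfl
  have h' : ∀ w, ¬ (addPendants G).Adj (.inr v) (.inr w) := fun _ => id
  simp only [h, h', Finset.sum_ite_eq, Finset.mem_univ, if_true, if_false,
    Finset.sum_const_zero, add_zero]

end

theorem degree_pathGraph {n : ℕ} [DecidableRel (SimpleGraph.pathGraph (n + 2)).Adj]
    (i : Fin (n + 2)) :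
    (SimpleGraph.pathGraph (n + 2)).degree i = if i = 0 ∨ i = Fin.last _ then 1 else 2 := by
  rw [← SimpleGraph.card_neighborFinset_eq_degree]
  split_ifs with h
  · rcases h with rfl | rfl
    · refine Finset.card_eq_one.2 ⟨⟨1, by omega⟩, ?_⟩
      ext j
      simp only [SimpleGraph.mem_neighborFinset, SimpleGraph.pathGraph_adj, Fin.ext_iff,
        Finset.mem_singleton, Fin.val_zero]
      omega
    · refine Finset.card_eq_one.2 ⟨⟨n, by omega⟩, ?_⟩
      ext j
      simp only [SimpleGraph.mem_neighborFinset, SimpleGraph.pathGraph_adj, Fin.ext_iff,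
        Finset.mem_singleton, Fin.val_last]
      omega
  · simp only [not_or, Fin.ext_iff, Fin.val_zero, Fin.val_last] at h
    refine Finset.card_eq_two.2 ⟨⟨i - 1, by omega⟩, ⟨i + 1, by omega⟩, ?_, ?_⟩
    · simp [Fin.ext_iff]
    · ext j
      simp only [SimpleGraph.mem_neighborFinset, SimpleGraph.pathGraph_adj, Fin.ext_iff,
        Finset.mem_singleton, Finset.mem_insert]
      omega

theorem ClassB.degreeWeight_eq {V : Type u} {G : SimpleGraph V} (hG : ClassB G) [Fintype V]
    [DecidableRel G.Adj] : degreeWeight G = 7 * G.indepNum + 2 := by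
  classical
  obtain ⟨n, hn, ⟨e⟩⟩ := hG
  obtain ⟨n, rfl⟩ := Nat.exists_eq_add_of_le' hn
  rw [degreeWeight_congr e, indepNum_congr e, indepNum_addPendants, degreeWeight,
    Fintype.sum_sum_type]
  simp only [degree_addPendants_inl, degree_addPendants_inr, degree_pathGraph]
  -- The two ends of the path are split off: they have degree 2, the `n` inner vertices degree 3,
  -- and all `n + 2` leaves degree 1, so the total is 6 + 2n + 5(n + 2) = 7(n + 2) + 2.
  rw [Fin.sum_univ_succ, Fin.sum_univ_castSucc]
  have h : ∀ i : Fin n, ¬ (i.castSucc.succ = (0 : Fin (n + 2)) ∨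
      i.castSucc.succ = Fin.last (n + 1)) := fun i => by
    simp only [Fin.ext_iff, Fin.val_succ, Fin.val_castSucc, Fin.val_zero, Fin.val_last]
    omega
  simp only [h, Fin.succ_last, if_true, if_false, true_or, or_true, degreeValue,
    Finset.sum_const, Finset.card_univ, Fintype.card_fin, smul_eq_mul]
  ring

end SubcubicIndependence

theorem corollary4 {V : Type u} [Fintype V] (G : SimpleGraph V) [DecidableRel G.Adj] :
    (SubcubicIndependence.ClassG G →
      (G.indepNum : ℝ) ≥
        5 / 7 * ((SubcubicIndependence.degreeClass G 1).card : ℝ)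
          + 3 / 7 * ((SubcubicIndependence.degreeClass G 2).card : ℝ)
          + 2 / 7 * ((SubcubicIndependence.degreeClass G 3).card : ℝ) - 2 / 7) ∧
    (SubcubicIndependence.ClassA G ∨ SubcubicIndependence.ClassB G →
      (G.indepNum : ℝ) =
        5 / 7 * ((SubcubicIndependence.degreeClass G 1).card : ℝ)
          + 3 / 7 * ((SubcubicIndependence.degreeClass G 2).card : ℝ)
          + 2 / 7 * ((SubcubicIndependence.degreeClass G 3).card : ℝ) - 2 / 7) := by
  have hw := SubcubicIndependence.degreeWeight_eq G
  constructor
  · intro hG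
    have h := SubcubicIndependence.degreeWeight_le G hG.connected hG.subcubic hG.three_le_card
    rw [hw] at h
    have h' := (Nat.cast_le (α := ℝ)).2 h
    push_cast at h'
    linarith
  · intro hG
    have h : SubcubicIndependence.degreeWeight G = 7 * G.indepNum + 2 :=
      hG.elim (fun h => h.degreeWeight_eq) fun h => h.degreeWeight_eq
    rw [hw] at h
    have h' := congrArg (Nat.cast (R := ℝ)) h
    push_cast at h'
    linarith
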